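/- For a finite set $X$, let $T(X)$ be the semigroup of all functions $X\to X$ under composition. For a finite non-commutative semigroup $S$ with center $Z(S)$, the commuting graph $\mathcal{G}(S)$ is the simple graph with vertex set $S\setminus Z(S)$ in which two vertices $a,b$ are adjacent if and only if $a\neq b$ and $ab=ba$. The diameter of a graph is the maximum of the distances $d(u,w)$ (lengths of shortest paths) over all vertices $u,w$, where $d(u,w)=\infty$ if there is no path from $u$ to $w$. Theorem. Let $X$ be a finite set with $n\geq 2$ elements. Then: (1) If $n$ is prime, then $\mathcal{G}(T(X))$ is not connected. (2) If $n=4$, then the diameter of $\mathcal{G}(T(X))$ is $4$. (3) If $n\geq 6$ is composite, then the diameter of $\mathcal{G}(T(X))$ is $5$. -/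

import Mathlib

/-!
Only the identity is central, so the diameter is at most `k` when any two non-identity
transformations are joined by `k` steps between non-identity transformations, each commuting with
the one before.

For composite `n` the paths of length five lead through the constants: `a` commutes with the
constant at `x` if and only if `a x = x`. If `a` is not an `n`-cycle, it reaches some constant in
two steps, and it commutes with some `c` that reaches every constant in two steps. If `a` is an
`n`-cycle, its powers of prime order `p < n` are such elements `c`. This joins all pairs except two
`n`-cycles. For these, take `p ≤ √n` and compare the orbits of the two powers of order `p`. If an
orbit of one misses an orbit of the other, the cycles on these orbits commute. If all orbits meet,
they are the rows and columns of a `p × p` grid, and collapsing equivariantly along each of the two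
directions gives commuting maps. For `n = 4` a shorter list of stops is available on the Klein
four-group: every `a` commutes with a constant, a translation, a map moving one point only, or an
idempotent commuting with a translation, and any two of these commute with a common element.

Distances are bounded from below by means of transformations `a` that generate all of `X` from one
point. Anything commuting with `a` is a power of `a`, so whatever is two steps away from `a`
commutes with the idempotent power of `a`, or with a power of prime order if `a` is an `n`-cycle.
If only the identity commutes with such powers of both `a` and `b`, then `a` and `b` are at least
five steps apart. For prime `n` the powers of an `n`-cycle are a component of their own.
-/

/-- The commuting graph `𝒢(S)` of a semigroup `S`: its vertices are the elements of `S` that are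
not in the center `Z(S)`, and two vertices `a`, `b` are adjacent if and only if `a ≠ b` and
`a * b = b * a`. -/
def commutingGraph (S : Type*) [Semigroup S] :
    SimpleGraph {a : S // a ∉ Subsemigroup.center S} where
  Adj a b := a ≠ b ∧ (a : S) * (b : S) = (b : S) * (a : S)
  symm := ⟨fun _ _ h => ⟨h.1.symm, h.2.symm⟩⟩
  loopless := ⟨fun _ h => h.1 rfl⟩

/-- The full transformation semigroup `T(X)`: all functions from `X` to `X`, multiplied by
composition (the two orders of composition have the same commuting pairs, hence the same
commuting graph). -/
abbrev FullTransformation (X : Type*) : Type _ := Function.End X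

theorem edist_map_le_edist {V W : Type*} {G : SimpleGraph V} {H : SimpleGraph W} (f : G →g H)
    (u v : V) : H.edist (f u) (f v) ≤ G.edist u v :=
  le_iInf fun w => (SimpleGraph.edist_le (w.map f)).trans_eq (by rw [SimpleGraph.Walk.length_map])

theorem ediam_le_ediam_of_iso {V W : Type*} {G : SimpleGraph V} {H : SimpleGraph W}
    (e : G ≃g H) : H.ediam ≤ G.ediam := by
  refine SimpleGraph.ediam_le_iff.2 fun u v => ?_
  calc H.edist u v = H.edist (e (e.symm u)) (e (e.symm v)) := by
        rw [e.apply_symm_apply, e.apply_symm_apply]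
    _ ≤ G.edist (e.symm u) (e.symm v) := edist_map_le_edist e.toHom _ _
    _ ≤ G.ediam := SimpleGraph.edist_le_ediam

theorem ediam_eq_of_iso {V W : Type*} {G : SimpleGraph V} {H : SimpleGraph W} (e : G ≃g H) :
    G.ediam = H.ediam :=
  (ediam_le_ediam_of_iso e.symm).antisymm (ediam_le_ediam_of_iso e)

section CommutingChain

variable {S T : Type*} [Semigroup S] [Semigroup T] {a b : S}

/-- Isomorphic semigroups have isomorphic commuting graphs. -/
def commutingGraphCongr (e : S ≃* T) : commutingGraph S ≃g commutingGraph T where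
  toEquiv := e.toEquiv.subtypeEquiv fun _ =>
    not_congr (MulEquivClass.apply_mem_center_iff e).symm
  map_rel_iff' {a b} := by
    simp [commutingGraph, Subtype.ext_iff, ← map_mul]

/-- `CommutingChain k a b` says that `b` is reached from `a` in exactly `k` steps, each of which
goes to a non-central element commuting with the current one. An element commutes with itself, so
a step may stand still; hence this is a distance of at most `k` in the commuting graph. -/
def CommutingChain : ℕ → S → S → Prop
  | 0, a, b => a = b
  | k + 1, a, b => ∃ c ∉ Subsemigroup.center S, Commute a c ∧ CommutingChain k c b

theorem commutingChain_of_walk_length_le {a b : {a : S // a ∉ Subsemigroup.center S}} {k : ℕ}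
    (w : (commutingGraph S).Walk a b) (hk : w.length ≤ k) : CommutingChain k (a : S) b := by
  induction k generalizing a with
  | zero => exact congrArg _ (w.eq_of_length_eq_zero (Nat.le_zero.1 hk))
  | succ k ih =>
    cases w with
    | nil => exact ⟨b, b.2, Commute.refl _, ih .nil (Nat.zero_le k)⟩
    | @cons _ c _ hadj w => exact ⟨c, c.2, hadj.2, ih w (Nat.le_of_succ_le_succ hk)⟩

theorem edist_le_of_commutingChain {a b : {a : S // a ∉ Subsemigroup.center S}} {k : ℕ}
    (h : CommutingChain k (a : S) b) : (commutingGraph S).edist a b ≤ k := by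
  induction k generalizing a with
  | zero => simp [Subtype.ext h]
  | succ k ih =>
    obtain ⟨c, hc, hac, hcb⟩ := h
    have hle : (commutingGraph S).edist a ⟨c, hc⟩ ≤ 1 := by
      refine SimpleGraph.edist_le_one_iff_adj_or_eq.2 (or_iff_not_imp_right.2 fun hne => ?_)
      exact ⟨hne, hac⟩
    calc (commutingGraph S).edist a b
        ≤ (commutingGraph S).edist a ⟨c, hc⟩ + (commutingGraph S).edist ⟨c, hc⟩ b :=
          SimpleGraph.edist_triangle
      _ ≤ 1 + k := add_le_add hle (ih hcb)
      _ = (k + 1 : ℕ) := by rw [add_comm, Nat.cast_succ]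

theorem edist_le_iff_commutingChain {a b : {a : S // a ∉ Subsemigroup.center S}} {k : ℕ} :
    (commutingGraph S).edist a b ≤ k ↔ CommutingChain k (a : S) b := by
  refine ⟨fun h => ?_, edist_le_of_commutingChain⟩
  obtain ⟨w, hw⟩ := SimpleGraph.exists_walk_of_edist_ne_top
    (h.trans_lt (ENat.natCast_lt_top k)).ne
  exact commutingChain_of_walk_length_le w (by exact_mod_cast hw.trans_le h)

theorem CommutingChain.symm {k : ℕ} (ha : a ∉ Subsemigroup.center S)
    (hb : b ∉ Subsemigroup.center S) (h : CommutingChain k a b) : CommutingChain k b a := by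
  have := edist_le_of_commutingChain (a := ⟨a, ha⟩) (b := ⟨b, hb⟩) h
  rw [SimpleGraph.edist_comm] at this
  exact edist_le_iff_commutingChain.1 this

theorem ediam_commutingGraph_le_iff {k : ℕ} :
    (commutingGraph S).ediam ≤ k ↔ ∀ a ∉ Subsemigroup.center S, ∀ b ∉ Subsemigroup.center S,
      CommutingChain k a b := by
  simp only [SimpleGraph.ediam_le_iff, edist_le_iff_commutingChain, Subtype.forall]

end CommutingChain

theorem exists_isIdempotentElem_pow {M : Type*} [Monoid M] [Finite M] (a : M) :
    ∃ m ≠ 0, IsIdempotentElem (a ^ m) := by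
  let _ : TopologicalSpace M := ⊥
  have : DiscreteTopology M := ⟨rfl⟩
  let s : Set M := {g | ∃ m ≠ 0, a ^ m = g}
  have hs : s.Nonempty := ⟨a, 1, one_ne_zero, pow_one a⟩
  have hmul : ∀ g ∈ s, ∀ h ∈ s, g * h ∈ s := by
    rintro _ ⟨k, hk, rfl⟩ _ ⟨l, -, rfl⟩
    exact ⟨k + l, by omega, pow_add a k l⟩
  obtain ⟨_, ⟨m, hm, rfl⟩, hidem⟩ := exists_idempotent_in_compact_subsemigroup
    (fun _ => continuous_of_discreteTopology) s hs
    s.toFinite.isCompact hmul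
  exact ⟨m, hm, hidem⟩

/-- The witness `p` is any prime factor of `N / gcd k N`. -/
theorem exists_prime_exists_pow_eq_pow_div {M : Type*} [Monoid M] {a : M} {N k : ℕ} (hN : N ≠ 0)
    (ha : a ^ N = 1) (hk : a ^ k ≠ 1) :
    ∃ p, p.Prime ∧ p ∣ N ∧ ∃ m, (a ^ k) ^ m = a ^ (N / p) := by
  set d := k.gcd N with hd
  have hdN : d ∣ N := Nat.gcd_dvd_right k N
  have hd0 : d ≠ 0 := ne_zero_of_dvd_ne_zero hN hdN
  have hne : d ≠ N := by
    intro h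
    obtain ⟨l, rfl⟩ : N ∣ k := h ▸ Nat.gcd_dvd_left k N
    exact hk (by rw [pow_mul, ha, one_pow])
  obtain ⟨m, -, hm⟩ :=
    Nat.exists_mul_mod_eq_gcd ((Nat.le_of_dvd (Nat.pos_of_ne_zero hN) hdN).lt_of_ne hne)
  obtain ⟨l, hl⟩ := hdN
  have hl1 : l ≠ 1 := by
    rintro rfl
    exact hne (by rw [hl, mul_one])
  obtain ⟨p, hp, q, rfl⟩ := Nat.exists_prime_and_dvd hl1
  refine ⟨p, hp, ⟨d * q, by rw [hl]; ring⟩, m * q, ?_⟩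
  have hdiv : N / p = d * q := by
    rw [hl, mul_left_comm, Nat.mul_div_cancel_left _ hp.pos]
  calc (a ^ k) ^ (m * q) = (a ^ (k * m)) ^ q := by rw [pow_mul, ← pow_mul a]
    _ = (a ^ d) ^ q := by rw [pow_eq_pow_mod (k * m) ha, hm]
    _ = a ^ (N / p) := by rw [← pow_mul, hdiv]

theorem eq_of_natCast_zmod_eq {r i j : ℕ} (hi : i < r) (hj : j < r) (h : (i : ZMod r) = j) :
    i = j :=
  CharP.natCast_injOn_Iio (ZMod r) r hi hj h

theorem two_ne_zero_zmod {r : ℕ} (hr : 3 ≤ r) : (2 : ZMod r) ≠ 0 := fun h =>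
  two_ne_zero (eq_of_natCast_zmod_eq (r := r) (i := 2) (j := 0) (by omega) (by omega)
    (by exact_mod_cast h))

namespace FullTransformation

variable {X Y : Type*} {a b e : FullTransformation X} {x : X}

@[simp]
theorem one_apply (x : X) : (1 : FullTransformation X) x = x := rfl

@[simp]
theorem mul_apply (a b : FullTransformation X) (x : X) : (a * b) x = a (b x) := rfl

theorem commute_iff : Commute a b ↔ ∀ x, a (b x) = b (a x) :=
  funext_iff

theorem ne_one_of_apply_ne (h : a x ≠ x) : a ≠ 1 := by
  rintro rfl
  exact h rfl

/-- The constant transformation with value `x`. -/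
def const (x : X) : FullTransformation X := fun _ => x

theorem const_apply (x y : X) : const x y = x := rfl

theorem commute_const_iff : Commute a (const x) ↔ a x = x :=
  ⟨fun h => congrFun h x, fun h => funext fun _ => h⟩

theorem const_ne_one [Nontrivial X] (x : X) : const x ≠ 1 := by
  obtain ⟨y, hy⟩ := exists_ne x
  exact ne_one_of_apply_ne hy.symm

/-- Commuting with every constant forces `a` to be the identity. -/
theorem notMem_center_iff : a ∉ Subsemigroup.center (FullTransformation X) ↔ a ≠ 1 := by
  rw [ne_eq, not_iff_not, Subsemigroup.mem_center_iff]
  refine ⟨fun h => funext fun x => ?_, ?_⟩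
  · exact commute_const_iff.1 (h (const x)).symm
  · rintro rfl g
    rw [mul_one, one_mul]

theorem commutingChain_succ_iff {k : ℕ} :
    CommutingChain (k + 1) a b ↔ ∃ c ≠ 1, Commute a c ∧ CommutingChain k c b := by
  simp only [CommutingChain, notMem_center_iff]

theorem ediam_le_iff {k : ℕ} : (commutingGraph (FullTransformation X)).ediam ≤ k ↔
    ∀ a b : FullTransformation X, a ≠ 1 → b ≠ 1 → CommutingChain k a b := by
  simp only [ediam_commutingGraph_le_iff, notMem_center_iff]
  tauto

theorem le_ediam {k : ℕ} (ha : a ≠ 1) (hb : b ≠ 1) (h : ¬ CommutingChain k a b) :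
    ((k + 1 : ℕ) : ℕ∞) ≤ (commutingGraph (FullTransformation X)).ediam := by
  rw [Nat.cast_succ, ENat.add_one_le_iff (ENat.natCast_ne_top k)]
  exact not_le.1 fun hle => h (ediam_le_iff.1 hle a b ha hb)

/-- Conjugation by a bijection `u`, as an isomorphism of full transformation semigroups. -/
def congr (u : X ≃ Y) : FullTransformation X ≃* FullTransformation Y where
  toEquiv := u.conj
  map_mul' a b := funext fun y => congrArg (u ∘ a) (u.symm_apply_apply (b (u.symm y))).symm

theorem congr_apply (u : X ≃ Y) (a : FullTransformation X) (y : Y) :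
    congr u a y = u (a (u.symm y)) := rfl

theorem ediam_eq_of_equiv (u : X ≃ Y) :
    (commutingGraph (FullTransformation X)).ediam =
      (commutingGraph (FullTransformation Y)).ediam :=
  ediam_eq_of_iso (commutingGraphCongr (congr u))

open Classical in
/-- The idempotent that moves `p` to `q` and fixes every other point. -/
noncomputable def collapse (p q : X) : FullTransformation X := Function.update id p q

@[simp]
theorem collapse_self (p q : X) : collapse p q p = q := by
  simp [collapse]

theorem collapse_of_ne {p q z : X} (h : z ≠ p) : collapse p q z = z := by
  simp [collapse, h]

theorem collapse_ne_one {p q : X} (h : p ≠ q) : collapse p q ≠ 1 :=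
  ne_one_of_apply_ne (x := p) (by simpa using h.symm)

theorem commute_collapse_of_injective {p q : X} (ha : Function.Injective a) (hp : a p = p)
    (hq : a q = q) : Commute a (collapse p q) := by
  refine commute_iff.2 fun z => ?_
  by_cases hz : z = p
  · rw [hz, hp, collapse_self, hq]
  · rw [collapse_of_ne hz, collapse_of_ne fun h => hz (ha (h.trans hp.symm))]

theorem commute_collapse_of_apply_eq {p q : X} (hpq : a p = a q) (hp : ∀ z, a z ≠ p) :
    Commute a (collapse p q) := by
  refine commute_iff.2 fun z => ?_
  rw [collapse_of_ne (hp z)]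
  by_cases hz : z = p
  · rw [hz, collapse_self, hpq]
  · rw [collapse_of_ne hz]

theorem isIdempotentElem_collapse (p q : X) : IsIdempotentElem (collapse p q) := by
  refine funext fun z => ?_
  by_cases hz : z = p
  · rw [mul_apply, hz, collapse_self]
    by_cases hq : q = p
    · rw [hq, collapse_self]
    · exact collapse_of_ne hq
  · rw [mul_apply, collapse_of_ne hz, collapse_of_ne hz]

theorem exists_isIdempotentElem_of_not_injective [Finite X] (ha : ¬ Function.Injective a) :
    ∃ e ≠ 1, Commute a e ∧ IsIdempotentElem e := by
  have : Finite (FullTransformation X) := inferInstanceAs (Finite (X → X))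
  obtain ⟨m, hm, hidem⟩ := exists_isIdempotentElem_pow a
  refine ⟨a ^ m, fun h => ha ?_, Commute.self_pow a m, hidem⟩
  refine Function.LeftInverse.injective (g := a ^ (m - 1)) fun x => ?_
  rw [← pow_sub_one_mul hm] at h
  exact congrFun h x

theorem exists_commute_of_common_fixed_point [Nontrivial X]
    (ha : a x = x) (hb : b x = x) : ∃ g ≠ 1, Commute a g ∧ Commute g b :=
  ⟨const x, const_ne_one x, commute_const_iff.2 ha, (commute_const_iff.2 hb).symm⟩

/-- The point `x` is fixed by some non-identity transformation that commutes with `a`. In terms of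
the commuting graph, `a` is at distance at most two from the constant with value `x`. -/
def IsFixable (a : FullTransformation X) (x : X) : Prop :=
  ∃ g ≠ 1, Commute a g ∧ g x = x

theorem commutingChain_five_of_isFixable [Nontrivial X] (hb : b ≠ 1) (hax : IsFixable a x)
    {c : FullTransformation X} (hc : c ≠ 1) (hbc : Commute b c) (hcx : IsFixable c x) :
    CommutingChain 5 a b := by
  obtain ⟨g, hg, hag, hgx⟩ := hax
  obtain ⟨h, hh, hch, hhx⟩ := hcx
  simp only [commutingChain_succ_iff]
  exact ⟨g, hg, hag, const x, const_ne_one x, commute_const_iff.2 hgx, h, hh,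
    (commute_const_iff.2 hhx).symm, c, hc, hch.symm, b, hb, hbc.symm, rfl⟩

theorem isFixable_of_isIdempotentElem [Finite X] (hX : 3 ≤ Nat.card X) (he : IsIdempotentElem e)
    (x : X) : IsFixable e x := by
  classical
  have hee (z : X) : e (e z) = e z := congrFun he z
  by_cases hconst : ∀ z, e z = e x
  · obtain ⟨w, hwx, hwe⟩ : ∃ w, w ≠ x ∧ w ≠ e x := by
      refine Cardinal.exists_ne_ne_of_three_le ?_ x (e x)
      rw [← Nat.cast_card]
      exact_mod_cast hX
    refine ⟨collapse w x, collapse_ne_one hwx, ?_, collapse_of_ne hwx.symm⟩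
    refine commute_iff.2 fun z => ?_
    rw [hconst, hconst z, collapse_of_ne hwe.symm]
  · push Not at hconst
    obtain ⟨y, hy⟩ := hconst
    refine ⟨fun z => if e z = e x then z else e x, ?_, commute_iff.2 fun z => ?_, if_pos rfl⟩
    · refine ne_one_of_apply_ne (x := y) ?_
      rw [if_neg hy]
      intro h
      exact hy (by rw [← h, hee])
    · grind

theorem exists_commute_const_of_isIdempotentElem [Finite X] (hX : 3 ≤ Nat.card X)
    (he : IsIdempotentElem e) (x : X) : ∃ g ≠ 1, Commute e g ∧ Commute g (const x) :=
  (isFixable_of_isIdempotentElem hX he x).imp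
    fun _ ⟨hg, heg, hgx⟩ => ⟨hg, heg, commute_const_iff.2 hgx⟩

theorem isFixable_of_two_fixed_points {p q : X} (ha : Function.Injective a) (hpq : p ≠ q)
    (hp : a p = p) (hq : a q = q) (x : X) : IsFixable a x := by
  by_cases hx : x = p
  · exact ⟨collapse q p, collapse_ne_one hpq.symm, commute_collapse_of_injective ha hq hp,
      collapse_of_ne (hx ▸ hpq)⟩
  · exact ⟨collapse p q, collapse_ne_one hpq, commute_collapse_of_injective ha hp hq,
      collapse_of_ne hx⟩

/-- The inclusion of the symmetric group into the full transformation semigroup. -/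
def ofPerm : Equiv.Perm X →* FullTransformation X := MulAction.toEndHom

@[simp]
theorem ofPerm_apply (σ : Equiv.Perm X) (x : X) : ofPerm σ x = σ x := rfl

theorem ofPerm_injective : Function.Injective (ofPerm : Equiv.Perm X → FullTransformation X) :=
  fun _ _ h => DFunLike.coe_injective h

/-- A permutation generating a group that acts semiregularly: a power of it with a fixed point is
the identity. -/
def IsSemiregular (σ : Equiv.Perm X) : Prop :=
  ∀ (i : ℤ) (x : X), (σ ^ i) x = x → σ ^ i = 1

section IsSemiregular

variable {σ τ : Equiv.Perm X}

theorem IsSemiregular.zpow_eq_zpow (hσ : IsSemiregular σ) {i j : ℤ}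
    (h : (σ ^ i) x = (σ ^ j) x) : σ ^ i = σ ^ j := by
  have hfix : (σ ^ (-j + i)) x = x := by
    rw [zpow_add, Equiv.Perm.mul_apply, h, zpow_neg, Equiv.Perm.inv_eq_iff_eq]
  have := hσ _ _ hfix
  rwa [zpow_add, zpow_neg, inv_mul_eq_one, eq_comm] at this

theorem IsSemiregular.zpow (hσ : IsSemiregular σ) (k : ℤ) : IsSemiregular (σ ^ k) := by
  intro i x h
  rw [← zpow_mul] at h ⊢
  exact hσ _ x h

theorem IsSemiregular.apply_ne (hσ : IsSemiregular σ) (hne : σ ≠ 1) (x : X) : σ x ≠ x :=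
  fun h => hne (by simpa using hσ 1 x (by simpa using h))

/-- A semiregular permutation acts freely on the orbits of `P`, so an equivariant map can be
prescribed arbitrarily on representatives. -/
theorem IsSemiregular.exists_commute_eqOn (hσ : IsSemiregular σ) {P : Set X}
    (hP : ∀ x ∈ P, ∀ y ∈ P, σ.SameCycle x y → x = y) (φ : X → X) :
    ∃ e : FullTransformation X, Commute (ofPerm σ) e ∧ Set.EqOn e φ P := by
  classical
  let e : FullTransformation X := fun z =>
    if h : ∃ w ∈ P, σ.SameCycle w z then (σ ^ h.choose_spec.2.choose) (φ h.choose) else z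
  have he {w : X} (hw : w ∈ P) (j : ℤ) : e ((σ ^ j) w) = (σ ^ j) (φ w) := by
    have hj : σ.SameCycle w ((σ ^ j) w) := ⟨j, rfl⟩
    have h : ∃ w' ∈ P, σ.SameCycle w' ((σ ^ j) w) := ⟨w, hw, hj⟩
    have hw' : h.choose = w := hP _ h.choose_spec.1 _ hw (h.choose_spec.2.trans hj.symm)
    have hpow : σ ^ h.choose_spec.2.choose = σ ^ j :=
      hσ.zpow_eq_zpow (h.choose_spec.2.choose_spec.trans (by rw [hw']))
    exact (dif_pos h).trans (by rw [hpow, hw'])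
  have he' {z : X} (h : ¬ ∃ w ∈ P, σ.SameCycle w z) : e z = z := dif_neg h
  refine ⟨e, commute_iff.2 fun z => ?_, fun w hw => by simpa using he hw 0⟩
  by_cases h : ∃ w ∈ P, σ.SameCycle w z
  · obtain ⟨w, hw, j, rfl⟩ := h
    have h1 := he hw (1 + j)
    rw [zpow_add, zpow_one] at h1
    rw [he hw]
    exact h1.symm
  · rw [he' h, ofPerm_apply, he' (by simpa only [Equiv.Perm.sameCycle_apply_right] using h)]

theorem IsSemiregular.isFixable (hσ : IsSemiregular σ) (hnot : ¬ ∀ x y, σ.SameCycle x y) (x : X) :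
    IsFixable (ofPerm σ) x := by
  obtain ⟨y, hy⟩ : ∃ y, ¬ σ.SameCycle x y := by
    contrapose! hnot
    exact fun y z => (hnot y).symm.trans (hnot z)
  obtain ⟨g, hg, hgx⟩ := hσ.exists_commute_eqOn (P := {x, y}) (φ := fun _ => x) (by
    rintro z (rfl | rfl) w (rfl | rfl) h
    exacts [rfl, (hy h).elim, (hy h.symm).elim, rfl])
  refine ⟨g, ne_one_of_apply_ne (x := y) ?_, hg, hgx (Set.mem_insert ..)⟩
  rw [hgx (Set.mem_insert_of_mem _ rfl)]
  exact fun hxy => hy (hxy ▸ Equiv.Perm.SameCycle.refl σ x)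

theorem isSemiregular_of_forall_sameCycle (h : ∀ x y, σ.SameCycle x y) : IsSemiregular σ := by
  intro i x hi
  ext y
  obtain ⟨j, rfl⟩ := h x y
  rw [← Equiv.Perm.mul_apply, (Commute.zpow_zpow_self σ i j).eq, Equiv.Perm.mul_apply, hi,
    Equiv.Perm.one_apply]

theorem orderOf_eq_card_of_forall_sameCycle [Nonempty X] (h : ∀ x y, σ.SameCycle x y) :
    orderOf σ = Nat.card X := by
  let x : X := Classical.arbitrary X
  rw [← Nat.card_zpowers]
  refine Nat.card_congr (Equiv.ofBijective (fun g : Subgroup.zpowers σ => (g : Equiv.Perm X) x)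
    ⟨?_, fun y => ?_⟩)
  · rintro ⟨_, i, rfl⟩ ⟨_, j, rfl⟩ hij
    exact Subtype.ext ((isSemiregular_of_forall_sameCycle h).zpow_eq_zpow hij)
  · obtain ⟨i, hi⟩ := h x y
    exact ⟨⟨σ ^ i, i, rfl⟩, hi⟩

theorem exists_isFixable_or_forall_sameCycle [Finite X] (hX : 3 ≤ Nat.card X) (ha : a ≠ 1) :
    ((∃ x, IsFixable a x) ∧ ∃ c ≠ 1, Commute a c ∧ ∀ x, IsFixable c x) ∨
      ∃ σ, a = ofPerm σ ∧ ∀ x y, σ.SameCycle x y := by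
  have : Nontrivial X := Finite.one_lt_card_iff_nontrivial.1 (by omega)
  by_cases hinj : Function.Injective a
  swap
  · obtain ⟨e, he, hae, hidem⟩ := exists_isIdempotentElem_of_not_injective hinj
    obtain ⟨x⟩ : Nonempty X := inferInstance
    exact .inl ⟨⟨e x, e, he, hae, congrFun hidem x⟩, e, he, hae,
      isFixable_of_isIdempotentElem hX hidem⟩
  obtain ⟨σ, rfl⟩ : ∃ σ, a = ofPerm σ :=
    ⟨Equiv.ofBijective a (Finite.injective_iff_bijective.1 hinj), rfl⟩
  by_cases hfix : ∃ x, σ x = x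
  · obtain ⟨x, hx⟩ := hfix
    have hcomm : Commute (ofPerm σ) (const x) := commute_const_iff.2 hx
    exact .inl ⟨⟨x, const x, const_ne_one x, hcomm, rfl⟩, const x, const_ne_one x, hcomm,
      isFixable_of_isIdempotentElem hX rfl⟩
  by_cases hσ : IsSemiregular σ
  · by_cases htrans : ∀ x y, σ.SameCycle x y
    · exact .inr ⟨σ, rfl, htrans⟩
    · exact .inl ⟨⟨Classical.arbitrary X, hσ.isFixable htrans _⟩, ofPerm σ, ha, Commute.refl _,
        hσ.isFixable htrans⟩
  · simp only [IsSemiregular, not_forall] at hσ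
    obtain ⟨i, x, hx, hne⟩ := hσ
    have hcomm : Commute (ofPerm σ) (ofPerm (σ ^ i)) :=
      (Commute.self_zpow σ i).map ofPerm
    have hne' : ofPerm (σ ^ i) ≠ 1 := fun h => hne (ofPerm_injective (h.trans (map_one _).symm))
    refine .inl ⟨⟨x, _, hne', hcomm, hx⟩, _, hne', hcomm, ?_⟩
    refine isFixable_of_two_fixed_points (σ ^ i).injective (fun h => hfix ⟨x, h.symm⟩) hx
      ((congrFun hcomm x).symm.trans (congrArg σ hx))

theorem exists_isFixable_of_forall_sameCycle {p : ℕ} (hp : p.Prime)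
    (hpX : p ∣ Nat.card X) (hlt : p < Nat.card X) (h : ∀ x y, σ.SameCycle x y) :
    ∃ τ : Equiv.Perm X, orderOf τ = p ∧ IsSemiregular τ ∧ Commute σ τ ∧
      ∀ x, IsFixable (ofPerm τ) x := by
  have hpos : 0 < Nat.card X := (Nat.zero_le p).trans_lt hlt
  have : Nonempty X := (Nat.card_pos_iff.1 hpos).1
  have horder : orderOf (σ ^ (Nat.card X / p)) = p := by
    have hdvd := Nat.div_dvd_of_dvd hpX
    rw [orderOf_pow_of_dvd, orderOf_eq_card_of_forall_sameCycle h,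
      Nat.div_div_self hpX hpos.ne']
    · exact (Nat.div_pos hlt.le hp.pos).ne'
    · rwa [orderOf_eq_card_of_forall_sameCycle h]
  have hsemi : IsSemiregular (σ ^ (Nat.card X / p)) := by
    simpa only [zpow_natCast] using
      (isSemiregular_of_forall_sameCycle h).zpow (Nat.card X / p : ℕ)
  refine ⟨_, horder, hsemi, Commute.self_pow .., hsemi.isFixable fun htrans => hlt.ne ?_⟩
  rw [← horder, orderOf_eq_card_of_forall_sameCycle htrans]

theorem exists_commute_triangle_of_disjoint [Finite X] (hσ : IsSemiregular σ)
    (hτ : IsSemiregular τ) (hσ1 : σ ≠ 1) (hτ1 : τ ≠ 1) {x y : X}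
    (hxy : ∀ z, ¬ (σ.SameCycle x z ∧ τ.SameCycle y z)) :
    ∃ e f : FullTransformation X, e ≠ 1 ∧ f ≠ 1 ∧
      Commute (ofPerm σ) e ∧ Commute (ofPerm τ) f ∧ Commute e f := by
  classical
  have := Fintype.ofFinite X
  have hcomm {ρ : Equiv.Perm X} {z : X} (hz : ρ z ≠ z) :
      ofPerm (ρ.cycleOf z) ≠ 1 ∧ Commute (ofPerm ρ) (ofPerm (ρ.cycleOf z)) := by
    refine ⟨ne_one_of_apply_ne (x := z) (by simpa using hz), Commute.map (Commute.symm ?_) ofPerm⟩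
    exact Equiv.Perm.self_mem_cycle_factors_commute
      (Equiv.Perm.cycleOf_mem_cycleFactorsFinset_iff.2 (Equiv.Perm.mem_support.2 hz))
  have hdisj : (σ.cycleOf x).Disjoint (τ.cycleOf y) := fun z => by
    simp only [Equiv.Perm.cycleOf_apply]
    grind
  exact ⟨_, _, (hcomm (hσ.apply_ne hσ1 x)).1, (hcomm (hτ.apply_ne hτ1 y)).1,
    (hcomm (hσ.apply_ne hσ1 x)).2, (hcomm (hτ.apply_ne hτ1 y)).2, hdisj.commute.map ofPerm⟩

/-- If all orbits meet, `X` is a quotient of the grid `zpowers σ × zpowers τ`, which has no more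
points than `X`; hence an orbit of `σ` meets an orbit of `τ` only once. -/
theorem eq_of_sameCycle_of_forall_inter_nonempty [Finite X]
    (hστ : orderOf σ * orderOf τ ≤ Nat.card X)
    (hmeet : ∀ x y, ∃ z, σ.SameCycle x z ∧ τ.SameCycle y z) {x y z : X} (hy : τ.SameCycle x y)
    (hz : τ.SameCycle x z) (hyz : σ.SameCycle y z) : y = z := by
  let F : Subgroup.zpowers σ × Subgroup.zpowers τ → X :=
    fun g => (g.1 : Equiv.Perm X) ((g.2 : Equiv.Perm X) x)
  have hsurj : Function.Surjective F := fun w => by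
    obtain ⟨v, ⟨i, hi⟩, ⟨j, hj⟩⟩ := hmeet w x
    refine ⟨(⟨σ ^ (-i), -i, rfl⟩, ⟨τ ^ j, j, rfl⟩), ?_⟩
    change (σ ^ (-i)) ((τ ^ j) x) = w
    rw [hj, ← hi, zpow_neg, Equiv.Perm.inv_eq_iff_eq]
  have hinj : Function.Injective F := by
    refine ((Nat.bijective_iff_surjective_and_card F).2 ⟨hsurj, le_antisymm ?_ ?_⟩).1
    · rwa [Nat.card_prod, Nat.card_zpowers, Nat.card_zpowers]
    · exact Nat.card_le_card_of_surjective F hsurj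
  obtain ⟨i, rfl⟩ := hy
  obtain ⟨j, rfl⟩ := hz
  obtain ⟨k, hk⟩ := hyz
  have := @hinj (⟨σ ^ k, k, rfl⟩, ⟨τ ^ i, i, rfl⟩) (1, ⟨τ ^ j, j, rfl⟩) hk
  exact congrFun (congrArg DFunLike.coe (congrArg Subtype.val (Prod.ext_iff.1 this).2)) x

theorem sameCycle_map_of_commute (h : Commute (ofPerm σ) e) {x y : X}
    (hxy : σ.SameCycle x y) : σ.SameCycle (e x) (e y) := by
  obtain ⟨i, rfl⟩ := hxy
  have hi : Commute (ofPerm (σ ^ i)) e := by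
    have := Commute.units_zpow_left (u := Units.map ofPerm (toUnits σ)) h i
    rwa [← map_zpow, ← map_zpow] at this
  exact ⟨i, commute_iff.1 hi x⟩

theorem exists_commute_triangle [Finite X] [Nonempty X] (hσ : IsSemiregular σ)
    (hτ : IsSemiregular τ) (hσ1 : σ ≠ 1) (hτ1 : τ ≠ 1)
    (hστ : orderOf σ * orderOf τ ≤ Nat.card X) :
    ∃ e f : FullTransformation X, e ≠ 1 ∧ f ≠ 1 ∧
      Commute (ofPerm σ) e ∧ Commute (ofPerm τ) f ∧ Commute e f := by
  by_cases hmeet : ∀ x y, ∃ z, σ.SameCycle x z ∧ τ.SameCycle y z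
  swap
  · push Not at hmeet
    obtain ⟨x, y, hxy⟩ := hmeet
    exact exists_commute_triangle_of_disjoint hσ hτ hσ1 hτ1 fun z hz => hxy z hz.1 hz.2
  have hmeet' (x y : X) : ∃ z, τ.SameCycle x z ∧ σ.SameCycle y z :=
    (hmeet y x).imp fun _ => And.symm
  have x : X := Classical.arbitrary X
  obtain ⟨e, hσe, he⟩ := hσ.exists_commute_eqOn (P := {y | τ.SameCycle x y})
    (fun _ hy _ hz => eq_of_sameCycle_of_forall_inter_nonempty hστ hmeet hy hz) fun _ => x
  obtain ⟨f, hτf, hf⟩ := hτ.exists_commute_eqOn (P := {y | σ.SameCycle x y})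
    (fun _ hy _ hz => eq_of_sameCycle_of_forall_inter_nonempty (by rwa [mul_comm]) hmeet' hy hz)
    fun _ => x
  have hfe (z : X) : f (e z) = x := by
    obtain ⟨w, hzw, hw⟩ := hmeet z x
    have hew : e w = x := he hw
    exact hf (hew ▸ (sameCycle_map_of_commute hσe hzw).symm)
  have hef (z : X) : e (f z) = x := by
    obtain ⟨w, hw, hzw⟩ := hmeet x z
    have hfw : f w = x := hf hw
    exact he (hfw ▸ (sameCycle_map_of_commute hτf hzw).symm)
  refine ⟨e, f, ?_, ?_, hσe, hτf, commute_iff.2 fun z => (hef z).trans (hfe z).symm⟩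
  · have hτx := he (x := τ x) ⟨1, by simp⟩
    exact ne_one_of_apply_ne (hτx.trans_ne (hτ.apply_ne hτ1 x).symm)
  · have hσx := hf (x := σ x) ⟨1, by simp⟩
    exact ne_one_of_apply_ne (hσx.trans_ne (hσ.apply_ne hσ1 x).symm)

theorem commutingChain_five [Finite X] (hX : 3 ≤ Nat.card X) (hprime : ¬ (Nat.card X).Prime)
    (ha : a ≠ 1) (hb : b ≠ 1) : CommutingChain 5 a b := by
  have : Nontrivial X := Finite.one_lt_card_iff_nontrivial.1 (by omega)
  obtain ⟨p, hp, hpX, hpp⟩ : ∃ p, p.Prime ∧ p ∣ Nat.card X ∧ p * p ≤ Nat.card X :=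
    ⟨_, Nat.minFac_prime (by omega), Nat.minFac_dvd _,
      sq (Nat.card X).minFac ▸ Nat.minFac_sq_le_self (by omega) hprime⟩
  have hlt : p < Nat.card X := (lt_mul_self hp.one_lt).trans_le hpp
  have hne {τ : Equiv.Perm X} (hτ : orderOf τ = p) : τ ≠ 1 := fun h => by
    rw [h, orderOf_one] at hτ
    exact hp.one_lt.ne hτ
  have hne' {τ : Equiv.Perm X} (hτ : orderOf τ = p) : ofPerm τ ≠ 1 := fun h =>
    hne hτ (ofPerm_injective (h.trans (map_one _).symm))
  rcases exists_isFixable_or_forall_sameCycle hX ha with ⟨⟨x, hx⟩, -⟩ | ⟨σ, rfl, hσ⟩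
  · rcases exists_isFixable_or_forall_sameCycle hX hb with ⟨-, d, hd, hbd, hdfix⟩ | ⟨τ, rfl, hτ⟩
    · exact commutingChain_five_of_isFixable hb hx hd hbd (hdfix x)
    · obtain ⟨τ', horder, -, hcomm, hfix⟩ :=
        exists_isFixable_of_forall_sameCycle hp hpX hlt hτ
      exact commutingChain_five_of_isFixable hb hx (hne' horder) (hcomm.map ofPerm) (hfix x)
  obtain ⟨σ', hσp, hσ', hσσ', hσfix⟩ := exists_isFixable_of_forall_sameCycle hp hpX hlt hσ
  rcases exists_isFixable_or_forall_sameCycle hX hb with ⟨⟨y, hy⟩, -⟩ | ⟨τ, rfl, hτ⟩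
  · exact (commutingChain_five_of_isFixable ha hy (hne' hσp) (hσσ'.map ofPerm) (hσfix y)).symm
      (notMem_center_iff.2 hb) (notMem_center_iff.2 ha)
  · obtain ⟨τ', hτp, hτ', hττ', -⟩ := exists_isFixable_of_forall_sameCycle hp hpX hlt hτ
    obtain ⟨e, f, he, hf, hσe, hτf, hef⟩ :=
      exists_commute_triangle hσ' hτ' (hne hσp) (hne hτp) (by rwa [hσp, hτp])
    simp only [commutingChain_succ_iff]
    exact ⟨_, hne' hσp, hσσ'.map ofPerm, e, he, hσe, f, hf, hef, _, hne' hτp, hτf.symm, _, hb,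
      (hττ'.map ofPerm).symm, rfl⟩

end IsSemiregular

/-- The point `x` generates `X` under iteration of `a`. The centralizer of such an `a` consists
of the powers of `a`, which makes distances from `a` in the commuting graph large. -/
def IsGeneratedBy (a : FullTransformation X) (x : X) : Prop :=
  ∀ z, ∃ i : ℕ, (a ^ i) x = z

theorem IsGeneratedBy.eq_of_commute (ha : IsGeneratedBy a x) {g h : FullTransformation X}
    (hg : Commute a g) (hh : Commute a h) (hx : g x = h x) : g = h := by
  funext z
  obtain ⟨i, rfl⟩ := ha z
  rw [← commute_iff.1 (hg.pow_left i), ← commute_iff.1 (hh.pow_left i), hx]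

theorem IsGeneratedBy.exists_pow_eq (ha : IsGeneratedBy a x) {g : FullTransformation X}
    (hg : Commute a g) : ∃ i, a ^ i = g := by
  obtain ⟨i, hi⟩ := ha (g x)
  exact ⟨i, ha.eq_of_commute (Commute.self_pow a i) hg hi⟩

theorem IsGeneratedBy.commute_of_isIdempotentElem_pow (ha : IsGeneratedBy a x) {m : ℕ}
    (hm : IsIdempotentElem (a ^ m)) {g h : FullTransformation X} (hg1 : g ≠ 1) (hg : Commute a g)
    (hgh : Commute g h) : Commute (a ^ m) h := by
  obtain ⟨i, rfl⟩ := ha.exists_pow_eq hg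
  have hi : i ≠ 0 := by
    rintro rfl
    exact hg1 (pow_zero a)
  have hpow : (a ^ i) ^ m = a ^ m := by
    rw [← pow_mul, mul_comm, pow_mul, hm.pow_eq hi]
  exact hpow ▸ hgh.pow_left m

theorem IsGeneratedBy.exists_prime_commute_pow (ha : IsGeneratedBy a x) {N : ℕ} (hN : N ≠ 0)
    (haN : a ^ N = 1) {g h : FullTransformation X} (hg1 : g ≠ 1) (hg : Commute a g)
    (hgh : Commute g h) : ∃ p, p.Prime ∧ p ∣ N ∧ Commute (a ^ (N / p)) h := by
  obtain ⟨i, rfl⟩ := ha.exists_pow_eq hg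
  obtain ⟨p, hp, hpN, m, hm⟩ := exists_prime_exists_pow_eq_pow_div hN haN hg1
  exact ⟨p, hp, hpN, hm ▸ hgh.pow_left m⟩

theorem not_commutingChain_three (ha : ∀ x, IsGeneratedBy a x) {y z : X} (hb : IsGeneratedBy b y)
    {m : ℕ} (hbm : b ^ m = const z) : ¬ CommutingChain 3 a b := by
  simp only [commutingChain_succ_iff]
  rintro ⟨g, hg1, hag, h, hh1, hgh, _, -, hhb, rfl⟩
  have hz := hb.commute_of_isIdempotentElem_pow (m := m) (by rw [hbm]; rfl) hh1 hhb.symm hgh.symm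
  rw [hbm] at hz
  exact hg1 ((ha z).eq_of_commute hag (Commute.one_right a) (commute_const_iff.1 hz.symm))

theorem not_commutingChain_four_of_isIdempotentElem {y : X} (ha : IsGeneratedBy a x)
    (hb : IsGeneratedBy b y) {k m : ℕ} (hak : IsIdempotentElem (a ^ k))
    (hbm : IsIdempotentElem (b ^ m))
    (hrigid : ∀ g, Commute (a ^ k) g → Commute (b ^ m) g → g = 1) : ¬ CommutingChain 4 a b := by
  simp only [commutingChain_succ_iff]
  rintro ⟨g, hg1, hag, h, hh1, hgh, l, hl1, hhl, _, -, hlb, rfl⟩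
  exact hh1 (hrigid h (ha.commute_of_isIdempotentElem_pow hak hg1 hag hgh)
    (hb.commute_of_isIdempotentElem_pow hbm hl1 hlb.symm hhl.symm))

theorem not_commutingChain_four_of_pow_eq_one {y : X} (ha : IsGeneratedBy a x)
    (hb : IsGeneratedBy b y) {N m : ℕ} (hN : N ≠ 0) (haN : a ^ N = 1)
    (hbm : IsIdempotentElem (b ^ m)) (hrigid : ∀ p, p.Prime → p ∣ N → ∀ g,
      Commute (a ^ (N / p)) g → Commute (b ^ m) g → g = 1) : ¬ CommutingChain 4 a b := by
  simp only [commutingChain_succ_iff]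
  rintro ⟨g, hg1, hag, h, hh1, hgh, l, hl1, hhl, _, -, hlb, rfl⟩
  obtain ⟨p, hp, hpN, hpow⟩ := ha.exists_prime_commute_pow hN haN hg1 hag hgh
  exact hh1 (hrigid p hp hpN h hpow
    (hb.commute_of_isIdempotentElem_pow hbm hl1 hlb.symm hhl.symm))

theorem exists_forall_pow_apply {u : ℕ → X} (hu : Function.Surjective u)
    (hnext : ∀ i j, u i = u j → u (i + 1) = u (j + 1)) :
    ∃ a : FullTransformation X, IsGeneratedBy a (u 0) ∧ ∀ k j, (a ^ k) (u j) = u (j + k) := by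
  let a : FullTransformation X := fun x => u (Function.surjInv hu x + 1)
  have ha (j : ℕ) : a (u j) = u (j + 1) := hnext _ _ (Function.surjInv_eq hu (u j))
  have hpow (k j : ℕ) : (a ^ k) (u j) = u (j + k) := by
    induction k generalizing j with
    | zero => rfl
    | succ k ih => rw [pow_succ, add_comm k, ← add_assoc, ← ih, ← ha]; rfl
  refine ⟨a, fun z => ?_, hpow⟩
  obtain ⟨j, rfl⟩ := hu z
  exact ⟨j, by rw [hpow, zero_add]⟩

section Translation

variable {G : Type*}

/-- Translation by `v` on an additive group, as a transformation. -/
def translation [Add G] (v : G) : FullTransformation G := (· + v)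

@[simp]
theorem translation_apply [Add G] (v x : G) : translation v x = x + v := rfl

theorem translation_pow [AddMonoid G] (v : G) (k : ℕ) :
    translation v ^ k = translation (k • v) := by
  induction k with
  | zero => exact funext fun x => by simp
  | succ k ih =>
    rw [pow_succ, ih]
    exact funext fun x => by simp [succ_nsmul', add_assoc]

theorem translation_one_isGeneratedBy {n : ℕ} [NeZero n] (x : ZMod n) :
    IsGeneratedBy (translation 1) x := fun z =>
  ⟨(z - x).val, by simp [translation_pow]⟩

theorem translation_one_pow_self (n : ℕ) : translation (1 : ZMod n) ^ n = 1 := by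
  rw [translation_pow]
  exact funext fun x => by simp

theorem translation_ne_one [AddLeftCancelMonoid G] {v : G} (hv : v ≠ 0) : translation v ≠ 1 :=
  ne_one_of_apply_ne (x := 0) (by simpa)

end Translation

theorem not_connected_zmod (p : ℕ) [hp : Fact p.Prime] :
    ¬ (commutingGraph (FullTransformation (ZMod p))).Connected := by
  intro hconn
  let a : FullTransformation (ZMod p) := translation 1
  have ha : a ≠ 1 := translation_ne_one one_ne_zero
  have hreach {v} (h : (commutingGraph _).Reachable ⟨a, notMem_center_iff.2 ha⟩ v) :
      Commute a v := by
    rw [SimpleGraph.reachable_iff_reflTransGen] at h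
    induction h with
    | refl => exact Commute.refl a
    | @tail v w _ hvw ih =>
      obtain ⟨q, hq, hqp, hqw⟩ :=
        (translation_one_isGeneratedBy (0 : ZMod p)).exists_prime_commute_pow hp.out.ne_zero
          (translation_one_pow_self p) (notMem_center_iff.1 v.2) ih hvw.2
      rwa [(Nat.prime_dvd_prime_iff_eq hq hp.out).1 hqp, Nat.div_self hp.out.pos, pow_one] at hqw
  have hconst := hreach (hconn ⟨a, _⟩ ⟨const 0, notMem_center_iff.2 (const_ne_one 0)⟩)
  simpa [a] using commute_const_iff.1 hconst

theorem four_le_ediam_zmod {n : ℕ} (hn : 2 ≤ n) :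
    4 ≤ (commutingGraph (FullTransformation (ZMod n))).ediam := by
  have : NeZero n := ⟨by omega⟩
  have : Fact (1 < n) := ⟨hn⟩
  let u : ℕ → ZMod n := fun j => (min j (n - 1) : ℕ)
  have hu (z : ZMod n) : u z.val = z := by
    have := z.val_lt
    simp [u, min_eq_left (Nat.le_sub_one_of_lt this)]
  have hnext (i j : ℕ) (h : u i = u j) : u (i + 1) = u (j + 1) := by
    have hval := congrArg ZMod.val h
    rw [ZMod.val_natCast_of_lt (by omega), ZMod.val_natCast_of_lt (by omega)] at hval
    exact congrArg Nat.cast (by omega : min (i + 1) (n - 1) = min (j + 1) (n - 1))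
  obtain ⟨b, hb, hpow⟩ := exists_forall_pow_apply (fun z => ⟨z.val, hu z⟩) hnext
  have hbconst : b ^ (n - 1) = const (u (n - 1)) := funext fun z => by
    rw [← hu z, hpow, const_apply]
    simp [u]
  refine le_ediam (k := 3) (translation_ne_one one_ne_zero) ?_
    (not_commutingChain_three translation_one_isGeneratedBy hb hbconst)
  rintro rfl
  rw [one_pow] at hbconst
  exact const_ne_one _ hbconst.symm

theorem IsGeneratedBy.congr (ha : IsGeneratedBy a x) (u : X ≃ Y) :
    IsGeneratedBy (FullTransformation.congr u a) (u x) := fun z => by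
  obtain ⟨i, hi⟩ := ha (u.symm z)
  exact ⟨i, by rw [← map_pow, congr_apply, u.symm_apply_apply, hi, u.apply_symm_apply]⟩

section Grid

variable {t r : ℕ}

/-- The set of points `(i, i)`, `(i, i + 1)` with `i : ZMod r` and `(j, j + 2)` with `j < t` of the
grid `ZMod r × ZMod r`. The summand `Fin t` stands for the points `(j, j + 2)`, the first summand
`ZMod r` for the points `(i, i)` and the second one for the points `(i, i + 1)`. -/
abbrev GridPoint (t r : ℕ) : Type := Fin t ⊕ ZMod r ⊕ ZMod r

namespace GridPoint

/-- The point `(i, i)`. -/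
abbrev diag (i : ZMod r) : GridPoint t r := .inr (.inl i)

/-- The point `(i, i + 1)`. -/
abbrev superdiag (i : ZMod r) : GridPoint t r := .inr (.inr i)

/-- The first coordinate of a grid point. -/
def row : GridPoint t r → ZMod r
  | .inl j => (j : ℕ)
  | .inr (.inl i) => i
  | .inr (.inr i) => i

/-- The second coordinate of a grid point. -/
def col : GridPoint t r → ZMod r
  | .inl j => (j : ℕ) + 2
  | .inr (.inl i) => i
  | .inr (.inr i) => i + 1

/-- The projection along rows onto the points `(i, i + 1)`. -/
def rowProj : FullTransformation (GridPoint t r) := fun z => superdiag z.row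

/-- The projection along columns onto the points `(i, i)`. -/
def colProj : FullTransformation (GridPoint t r) := fun z => diag z.col

/-- The permutation of the grid points that conjugates `rowProj` to `colProj`. -/
def swapDiag : Equiv.Perm (GridPoint t r) :=
  .sumCongr (.refl _) ((Equiv.sumComm _ _).trans
    (.sumCongr (Equiv.addRight 2) (Equiv.addRight 1)))

theorem congr_swapDiag_rowProj :
    FullTransformation.congr swapDiag (rowProj (t := t) (r := r)) = colProj := by
  funext z
  obtain ⟨z, rfl⟩ := swapDiag.surjective z
  rw [congr_apply, Equiv.symm_apply_apply]
  rcases z with j | i | i <;> simp [swapDiag, rowProj, colProj, row, col, add_assoc]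
  norm_num

theorem ext_of_three_le (hr : 3 ≤ r) (ht : t ≤ r) {y z : GridPoint t r} (hrow : y.row = z.row)
    (hcol : y.col = z.col) : y = z := by
  have : Fact (1 < r) := ⟨by omega⟩
  have h2 : (2 : ZMod r) ≠ 0 := two_ne_zero_zmod hr
  have hinj (i j : Fin t) : ((i : ℕ) : ZMod r) = (j : ℕ) ↔ i = j :=
    ⟨fun hij => Fin.ext (eq_of_natCast_zmod_eq (i.2.trans_le ht) (j.2.trans_le ht) hij),
      fun hij => hij ▸ rfl⟩
  have h12 : (1 : ZMod r) ≠ 2 := by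
    rw [← one_add_one_eq_two]
    simp
  rcases y with i | i | i <;> rcases z with j | j | j <;> simp_all [row, col]

/-- The sequence that runs through the points `(j, j + 2)`, then once through the diagonal
`(i, i)`, starting at `i = t`, and from there on round and round through the points `(i, i + 1)`.
The `j`-th term lies in row `j` modulo `r`, so `2 * r` steps never change the row. -/
def path (t r j : ℕ) : GridPoint t r :=
  if h : j < t then .inl ⟨j, h⟩ else if j < t + r then diag j else superdiag j

theorem path_of_lt {j : ℕ} (h : j < t) : path t r j = .inl ⟨j, h⟩ := dif_pos h

theorem path_of_le_of_lt {j : ℕ} (h : t ≤ j) (h' : j < t + r) : path t r j = diag j :=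
  (dif_neg h.not_gt).trans (if_pos h')

theorem path_of_le {j : ℕ} (h : t + r ≤ j) : path t r j = superdiag j :=
  (dif_neg (by omega)).trans (if_neg h.not_gt)

theorem exists_path_eq_and_natCast_eq_row [NeZero r] (ht : t < r) (z : GridPoint t r) :
    ∃ j, path t r j = z ∧ (j : ZMod r) = z.row := by
  rcases z with j | i | i
  · exact ⟨j, path_of_lt j.2, rfl⟩
  · by_cases hi : i.val < t
    · exact ⟨i.val + r, by rw [path_of_le_of_lt (by omega) (by omega)]; simp, by simp [row]⟩
    · have := i.val_lt
      exact ⟨i.val, by rw [path_of_le_of_lt (by omega) (by omega)]; simp, by simp [row]⟩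
  · exact ⟨i.val + 2 * r, by rw [path_of_le (by omega)]; simp, by simp [row]⟩

theorem path_succ_eq_path_succ {i j : ℕ} (h : path t r i = path t r j) :
    path t r (i + 1) = path t r (j + 1) := by
  have hij : i = j ∨ t + r ≤ i ∧ t + r ≤ j ∧ (i : ZMod r) = j := by
    simp only [path] at h
    split_ifs at h <;> simp only [Sum.inl.injEq, Sum.inr.injEq, Fin.mk.injEq, reduceCtorEq] at h
    · exact .inl h
    · have := eq_of_natCast_zmod_eq (r := r) (i := i - t) (j := j - t) (by omega) (by omega)
        (by rw [Nat.cast_sub (by omega), Nat.cast_sub (by omega), h])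
      omega
    · exact .inr ⟨by omega, by omega, h⟩
  rcases hij with rfl | ⟨hi, hj, hij⟩
  · rfl
  · rw [path_of_le (by omega), path_of_le (by omega), Nat.cast_succ, Nat.cast_succ, hij]

theorem exists_isGeneratedBy_pow_eq_rowProj [NeZero r] (ht : t < r) :
    ∃ a : FullTransformation (GridPoint t r),
      (∃ x, IsGeneratedBy a x) ∧ a ^ (2 * r) = rowProj := by
  have hpath := exists_path_eq_and_natCast_eq_row ht
  obtain ⟨a, ha, hpow⟩ := exists_forall_pow_apply (fun z => (hpath z).imp fun _ => And.left)
    fun _ _ => path_succ_eq_path_succ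
  refine ⟨a, ⟨_, ha⟩, funext fun z => ?_⟩
  obtain ⟨j, rfl, hj⟩ := hpath z
  rw [hpow, path_of_le (by omega)]
  simp [rowProj, ← hj]

theorem eq_zero_of_forall_exists_natCast_eq_add [NeZero r] (ht0 : 0 < t) (htr : t < r)
    {m : ZMod r} (h : ∀ j < t, ∃ j' < t, ((j' : ℕ) : ZMod r) = (j : ℕ) + m) : m = 0 := by
  have hm : m.val < t := by
    obtain ⟨j, hj, hjm⟩ := h 0 ht0
    rwa [← eq_of_natCast_zmod_eq (hj.trans htr) m.val_lt (by simpa using hjm)]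
  by_contra hne
  have hpos : 0 < m.val := Nat.pos_of_ne_zero fun h0 => hne ((ZMod.val_eq_zero m).1 h0)
  obtain ⟨j, hj, hjm⟩ := h (t - m.val) (by omega)
  refine hj.ne (eq_of_natCast_zmod_eq (hj.trans htr) htr (hjm.trans ?_))
  rw [Nat.cast_sub hm.le, ZMod.natCast_zmod_val, sub_add_cancel]

theorem exists_natCast_eq_row_of_col_eq (hr : 3 ≤ r) {z : GridPoint t r}
    (hz : z.col = z.row + 2) : ∃ j < t, (j : ZMod r) = z.row := by
  have : Fact (1 < r) := ⟨by omega⟩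
  rcases z with j | i | i
  · exact ⟨j, j.2, rfl⟩
  · exact absurd (left_eq_add.1 hz) (two_ne_zero_zmod hr)
  · rw [← one_add_one_eq_two] at hz
    simp [row, col] at hz

/-- Commuting with both projections makes `g` shift rows and columns by a common amount, which
vanishes because the points `(j, j + 2)` do not fill up their diagonal. -/
theorem eq_one_of_commute_rowProj_of_commute_colProj (hr : 3 ≤ r) (ht0 : 0 < t) (htr : t < r)
    {g : FullTransformation (GridPoint t r)} (hrow : Commute rowProj g) (hcol : Commute colProj g) :
    g = 1 := by
  have : NeZero r := ⟨by omega⟩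
  let γ : ZMod r → ZMod r := fun i => (g (diag i)).col
  have hdiag (i : ZMod r) : g (diag i) = diag (γ i) := (commute_iff.1 hcol (diag i)).symm
  have hsuper (i : ZMod r) : g (superdiag i) = superdiag (γ i) := by
    have h := commute_iff.1 hrow (diag i)
    rw [hdiag] at h
    exact h.symm
  have hstep (i : ZMod r) : γ (i + 1) = γ i + 1 := by
    have h := commute_iff.1 hcol (superdiag i)
    rw [hsuper] at h
    exact (congrArg col (h.trans (hdiag (i + 1)))).symm
  have hγ (i : ZMod r) : γ i = i + γ 0 := by
    rw [← ZMod.natCast_zmod_val i]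
    induction i.val with
    | zero => simp
    | succ k ih => rw [Nat.cast_succ, hstep, ih, add_right_comm]
  have hshift_row (z : GridPoint t r) : (g z).row = z.row + γ 0 := by
    have h := (commute_iff.1 hrow z).trans (hsuper z.row)
    exact (congrArg row h).trans (hγ _)
  have hshift_col (z : GridPoint t r) : (g z).col = z.col + γ 0 := by
    have h := (commute_iff.1 hcol z).trans (hdiag z.col)
    exact (congrArg row h).trans (hγ _)
  have hzero : γ 0 = 0 := by
    refine eq_zero_of_forall_exists_natCast_eq_add ht0 htr fun j hj => ?_
    have h := exists_natCast_eq_row_of_col_eq hr (z := g (.inl ⟨j, hj⟩))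
      (by rw [hshift_row, hshift_col]; exact add_right_comm _ _ _)
    rwa [hshift_row] at h
  exact funext fun z => ext_of_three_le hr htr.le (by simp [hshift_row, hzero])
    (by simp [hshift_col, hzero])

theorem five_le_ediam (hr : 3 ≤ r) (ht0 : 0 < t) (htr : t < r) :
    5 ≤ (commutingGraph (FullTransformation (GridPoint t r))).ediam := by
  have : NeZero r := ⟨by omega⟩
  obtain ⟨a, ⟨x, hx⟩, ha⟩ := exists_isGeneratedBy_pow_eq_rowProj htr
  have hcongr : FullTransformation.congr swapDiag a ^ (2 * r) = colProj (t := t) (r := r) := by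
    rw [← map_pow, ha, congr_swapDiag_rowProj]
  have hidem : IsIdempotentElem (FullTransformation.congr swapDiag a ^ (2 * r)) := by
    rw [hcongr]; rfl
  have hne : a ≠ 1 := by
    rintro rfl
    have := congrFun ha (diag 0)
    simp [rowProj] at this
  refine le_ediam (k := 4) hne ((map_ne_one_iff _ (MulEquiv.injective _)).2 hne)
    (not_commutingChain_four_of_isIdempotentElem hx (hx.congr swapDiag) (by rw [ha]; rfl) hidem ?_)
  rw [ha, hcongr]
  exact fun g => eq_one_of_commute_rowProj_of_commute_colProj hr ht0 htr

end GridPoint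

end Grid

section Six

/-- The idempotent map with fixed points `2`, `3`, `5` that moves `0` to `2`, `1` to `5` and `4` to
`3`. It is rigid with respect to the translations of prime order. -/
def rigidProj : ZMod 6 → ZMod 6 := ![2, 5, 2, 3, 3, 5]

variable {g : ZMod 6 → ZMod 6}

theorem eq_id_of_commute_rigidProj_of_commute_add_three
    (hg : Function.Commute rigidProj g) (hshift : Function.Commute (· + 3) g) : g = id := by
  have hg3 : g 3 = g 0 + 3 := (hshift 0).symm
  have hg4 : g 4 = g 1 + 3 := (hshift 1).symm
  have hg5 : g 5 = g 2 + 3 := (hshift 2).symm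
  have hvalues : ∀ x y : ZMod 6, rigidProj y = rigidProj x + 3 → rigidProj (x + 3) = x + 3 →
      rigidProj (y + 3) = x + 3 → x = 0 ∧ y = 1 := by decide
  have h2 : rigidProj (g 0) = g 2 := hg 0
  obtain ⟨h0, h1⟩ := hvalues (g 0) (g 1) (h2 ▸ hg5 ▸ hg 1) (hg3 ▸ hg 3) (hg3 ▸ hg4 ▸ hg 4)
  rw [h0] at hg3 h2
  rw [h1] at hg4
  rw [← h2] at hg5
  funext z
  fin_cases z
  exacts [h0, h1, h2.symm, hg3, hg4, hg5]

theorem eq_id_of_commute_rigidProj_of_commute_add_two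
    (hg : Function.Commute rigidProj g) (hshift : Function.Commute (· + 2) g) : g = id := by
  have hg2 : g 2 = g 0 + 2 := (hshift 0).symm
  have hg3 : g 3 = g 1 + 2 := (hshift 1).symm
  have hg4 : g 4 = g 0 + 2 + 2 := hg2 ▸ (hshift 2).symm
  have hg5 : g 5 = g 1 + 2 + 2 := hg3 ▸ (hshift 3).symm
  have hvalues : ∀ x y : ZMod 6, rigidProj x = x + 2 → rigidProj y = y + 2 + 2 →
      rigidProj (y + 2) = y + 2 → x = 0 ∧ y = 1 := by decide
  obtain ⟨h0, h1⟩ := hvalues (g 0) (g 1) (hg2 ▸ hg 0) (hg5 ▸ hg 1) (hg3 ▸ hg 3)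
  rw [h0] at hg2 hg4
  rw [h1] at hg3 hg5
  funext z
  fin_cases z <;> assumption

theorem five_le_ediam_zmod_six :
    5 ≤ (commutingGraph (FullTransformation (ZMod 6))).ediam := by
  -- Under `b` the point `0` runs through `0, 4, 1, 2, 3, 5` and then returns to `2`.
  let b : FullTransformation (ZMod 6) := ![4, 2, 3, 5, 1, 2]
  have hgen : ∀ z, ∃ i : Fin 6, (b ^ (i : ℕ)) 0 = z := by decide
  have hb : IsGeneratedBy b 0 := fun z => (hgen z).imp' _ fun _ => id
  have hcube (z : ZMod 6) : (b ^ 3) z = rigidProj z := by revert z; decide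
  have hidem : IsIdempotentElem (b ^ 3) := by
    have h : ∀ z, rigidProj (rigidProj z) = rigidProj z := by decide
    exact funext fun z => by simp only [mul_apply, hcube, h]
  refine le_ediam (k := 4) (translation_ne_one (by decide))
    (ne_one_of_apply_ne (x := 0) (by decide)) (not_commutingChain_four_of_pow_eq_one
      (translation_one_isGeneratedBy 0) hb (by decide) (translation_one_pow_self 6) hidem
      fun p hp hp6 g hag hbg => ?_)
  simp only [translation_pow, commute_iff, hcube] at hag hbg
  obtain rfl | rfl : p = 2 ∨ p = 3 := by
    have := Nat.le_of_dvd (by decide) hp6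
    interval_cases p <;> simp_all +decide
  · exact eq_id_of_commute_rigidProj_of_commute_add_three hbg hag
  · exact eq_id_of_commute_rigidProj_of_commute_add_two hbg hag

end Six

section Shift

variable {G : Type*} [AddCommGroup G] {v : G}

open Classical in
/-- The transformation that translates the points of `s` by `u` and fixes all other points. -/
noncomputable def shiftOn (s : Set G) (u : G) : FullTransformation G := fun z =>
  if z ∈ s then z + u else z

theorem shiftOn_of_mem {s : Set G} {u z : G} (h : z ∈ s) : shiftOn s u z = z + u := if_pos h

theorem shiftOn_of_notMem {s : Set G} {u z : G} (h : z ∉ s) : shiftOn s u z = z := if_neg h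

theorem commute_translation_shiftOn {s : Set G} (hs : ∀ z, z + v ∈ s ↔ z ∈ s) (u : G) :
    Commute (translation v) (shiftOn s u) := by
  refine commute_iff.2 fun z => ?_
  by_cases hz : z ∈ s
  · rw [shiftOn_of_mem hz, translation_apply, translation_apply, shiftOn_of_mem ((hs z).2 hz),
      add_right_comm]
  · rw [shiftOn_of_notMem hz, translation_apply, shiftOn_of_notMem (mt (hs z).1 hz)]

theorem commute_translation (v w : G) : Commute (translation v) (translation w) :=
  commute_iff.2 fun z => add_right_comm z w v

theorem add_eq_iff_eq_add (hv : v + v = 0) {p z : G} : z + v = p ↔ z = p + v := by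
  rw [← sub_eq_iff_eq_add, sub_eq_add_neg, neg_eq_of_add_eq_zero_left hv]

theorem add_mem_pair_iff (hv : v + v = 0) (p z : G) :
    z + v ∈ ({p, p + v} : Set G) ↔ z ∈ ({p, p + v} : Set G) := by
  rw [Set.mem_insert_iff, Set.mem_insert_iff, Set.mem_singleton_iff, Set.mem_singleton_iff,
    add_left_inj, add_eq_iff_eq_add hv, or_comm]

theorem exists_injective_commute_translation (hv : v + v = 0) (hv0 : v ≠ 0) {p w : G}
    (hw : w ∉ ({p, p + v} : Set G)) : ∃ g : FullTransformation G, g ≠ 1 ∧ Function.Injective g ∧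
      Commute (translation v) g ∧ g p = p ∧ g (p + v) = p + v := by
  have hs (z : G) : z + v ∈ ({p, p + v} : Set G)ᶜ ↔ z ∈ ({p, p + v} : Set G)ᶜ :=
    not_congr (add_mem_pair_iff hv p z)
  refine ⟨shiftOn {p, p + v}ᶜ v, ne_one_of_apply_ne (x := w) ?_, ?_,
    commute_translation_shiftOn hs v, shiftOn_of_notMem (by simp), shiftOn_of_notMem (by simp)⟩
  · rw [shiftOn_of_mem hw]
    simpa
  · refine Function.LeftInverse.injective (g := shiftOn {p, p + v}ᶜ v) fun z => ?_
    by_cases hz : z ∈ ({p, p + v} : Set G)ᶜ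
    · rw [shiftOn_of_mem hz, shiftOn_of_mem ((hs z).2 hz), add_assoc, hv, add_zero]
    · rw [shiftOn_of_notMem hz, shiftOn_of_notMem hz]

theorem exists_commute_translation_commute_collapse (hv : v + v = 0) {p q : G}
    (hpq : p ≠ q) (hq : q ≠ p + v) : ∃ g : FullTransformation G, g ≠ 1 ∧
      Commute (translation v) g ∧ Commute g (collapse p q) := by
  let s : Set G := {p, p + v}
  have hp : p ∈ s := Set.mem_insert p _
  have hqs : q ∉ s := by
    rintro (h | h)
    exacts [hpq h.symm, hq h]
  have hgp : shiftOn s (q - p) p = q := by rw [shiftOn_of_mem hp, add_sub_cancel]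
  refine ⟨shiftOn s (q - p), ne_one_of_apply_ne (x := p) (hgp.trans_ne hpq.symm),
    commute_translation_shiftOn (add_mem_pair_iff hv p) _,
    commute_collapse_of_apply_eq (hgp.trans (shiftOn_of_notMem hqs).symm) fun z h => ?_⟩
  by_cases hz : z ∈ s
  · rw [shiftOn_of_mem hz] at h
    rcases hz with rfl | rfl
    · exact hpq (by simpa using h.symm)
    · refine hq ((add_eq_iff_eq_add hv).1 ?_)
      rwa [add_right_comm, add_sub_cancel] at h
  · rw [shiftOn_of_notMem hz] at h
    exact hz (h ▸ hp)

theorem exists_apply_eq_self_and_ne {a : FullTransformation G} (he : IsIdempotentElem a)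
    (hv : v ≠ 0) (hva : Commute (translation v) a) (p : G) : ∃ z ≠ p, a z = z := by
  have hfix : a (a 0) = a 0 := congrFun he 0
  by_cases h : a 0 = p
  · refine ⟨a 0 + v, by simpa [h], ?_⟩
    rw [← translation_apply, ← commute_iff.1 hva, hfix]
  · exact ⟨a 0, h, hfix⟩

end Shift

section Klein

/-- The transformations of the Klein four-group that serve as intermediate stops: the constants,
the collapses, the translations, and the idempotents commuting with a translation. -/
inductive IsHub : FullTransformation (ZMod 2 × ZMod 2) → Prop
  | const (x : ZMod 2 × ZMod 2) : IsHub (const x)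
  | collapse {p q : ZMod 2 × ZMod 2} (hpq : p ≠ q) : IsHub (collapse p q)
  | translation {v : ZMod 2 × ZMod 2} (hv : v ≠ 0) : IsHub (translation v)
  | idempotent {e : FullTransformation (ZMod 2 × ZMod 2)} {v : ZMod 2 × ZMod 2} (he1 : e ≠ 1)
      (he : IsIdempotentElem e) (hv : v ≠ 0) (hve : Commute (.translation v) e) : IsHub e

variable {a b : FullTransformation (ZMod 2 × ZMod 2)}

theorem IsHub.ne_one (ha : IsHub a) : a ≠ 1 := by
  cases ha with
  | const x => exact const_ne_one x
  | collapse hpq => exact collapse_ne_one hpq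
  | translation hv => exact translation_ne_one hv
  | idempotent he1 => exact he1

/-- Suppose that `a` has no fixed point and that its image contains every fiber with several
points. If `a` is a permutation, it is a translation or a square root of one. Otherwise there are
points `p`, `q`, `n` with `a p = a q = n`, `a n = p` and the fourth point mapped to `q`, and
`v = n - p` works. -/
theorem exists_fixed_or_exists_fold_or_exists_translation :
    ∀ a : ZMod 2 × ZMod 2 → ZMod 2 × ZMod 2, (∃ x, a x = x) ∨
      (∃ p q, p ≠ q ∧ a p = a q ∧ ∀ z, a z ≠ p) ∨ ∃ v, v ≠ 0 ∧ ((∀ z, a z = z + v) ∨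
        (∀ z, a (a z) = z + v) ∨ (∃ z, a (a z) ≠ z) ∧ (∀ z, a (a (a (a z))) = a (a z)) ∧
          ∀ z, a (a z) + v = a (a (z + v))) := by
  set_option synthInstance.maxSize 1000 in
  decide +kernel

theorem exists_isHub_commute (a : FullTransformation (ZMod 2 × ZMod 2)) :
    ∃ c, IsHub c ∧ Commute a c := by
  rcases exists_fixed_or_exists_fold_or_exists_translation a with
    ⟨x, hx⟩ | ⟨p, q, hpq, ha, hp⟩ | ⟨v, hv, ha | ha | ⟨⟨z, hz⟩, hidem, hcomm⟩⟩
  · exact ⟨const x, .const x, commute_const_iff.2 hx⟩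
  · exact ⟨collapse p q, .collapse hpq, commute_collapse_of_apply_eq ha hp⟩
  · exact ⟨a, (funext ha : a = translation v) ▸ .translation hv, Commute.refl a⟩
  · exact ⟨a * a, (funext ha : a * a = translation v) ▸ .translation hv,
      (Commute.refl a).mul_right (Commute.refl a)⟩
  · exact ⟨a * a, .idempotent (ne_one_of_apply_ne hz) (funext hidem) hv (commute_iff.2 hcomm),
      (Commute.refl a).mul_right (Commute.refl a)⟩

theorem exists_commute_translation_of_isHub (hb : IsHub b) {v : ZMod 2 × ZMod 2} (hv : v ≠ 0) :
    ∃ g : FullTransformation (ZMod 2 × ZMod 2),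
      g ≠ 1 ∧ Commute (translation v) g ∧ Commute g b := by
  have hself : ∀ v : ZMod 2 × ZMod 2, v + v = 0 := by decide
  have houtside : ∀ v p : ZMod 2 × ZMod 2, ∃ w, ¬ (w = p ∨ w = p + v) := by decide
  have hfix (p : ZMod 2 × ZMod 2) : ∃ g : FullTransformation (ZMod 2 × ZMod 2), g ≠ 1 ∧
      Function.Injective g ∧ Commute (translation v) g ∧ g p = p ∧ g (p + v) = p + v :=
    (houtside v p).elim fun _ hw => exists_injective_commute_translation (hself v) hv hw
  cases hb with
  | const x =>
    obtain ⟨g, hg, -, hvg, hx, -⟩ := hfix x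
    exact ⟨g, hg, hvg, commute_const_iff.2 hx⟩
  | @collapse p q hpq =>
    by_cases hq : q = p + v
    · obtain ⟨g, hg, hinj, hvg, hp, hpv⟩ := hfix p
      exact ⟨g, hg, hvg, commute_collapse_of_injective hinj hp (by rwa [hq])⟩
    · exact exists_commute_translation_commute_collapse (hself v) hpq hq
  | translation hw => exact ⟨_, translation_ne_one hw, commute_translation v _, .refl _⟩
  | idempotent _ _ hw hwb => exact ⟨_, translation_ne_one hw, commute_translation v _, hwb⟩

theorem exists_commute_of_commute_translation {v w : ZMod 2 × ZMod 2} (ha : IsIdempotentElem a)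
    (hb : IsIdempotentElem b) (hv : v ≠ 0) (hw : w ≠ 0) (hva : Commute (translation v) a)
    (hwb : Commute (translation w) b) : ∃ g ≠ 1, Commute a g ∧ Commute g b := by
  by_cases hvw : v = w
  · exact ⟨translation v, translation_ne_one hv, hva.symm, hvw ▸ hwb⟩
  have hmeet : ∀ v w x y : ZMod 2 × ZMod 2, v ≠ 0 → w ≠ 0 → v ≠ w →
      ∃ z, (z = x ∨ z = x + v) ∧ (z = y ∨ z = y + w) := by
    set_option synthInstance.maxSize 1000 in
    decide +kernel
  obtain ⟨z, hza, hzb⟩ := hmeet v w (a 0) (b 0) hv hw hvw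
  refine exists_commute_of_common_fixed_point (x := z) ?_ ?_
  · have h : a (a 0) = a 0 := congrFun ha 0
    rcases hza with rfl | rfl
    exacts [h, by rw [← translation_apply, ← commute_iff.1 hva, h]]
  · have h : b (b 0) = b 0 := congrFun hb 0
    rcases hzb with rfl | rfl
    exacts [h, by rw [← translation_apply, ← commute_iff.1 hwb, h]]

theorem exists_commute_collapse_of_isHub {p q : ZMod 2 × ZMod 2} (hpq : p ≠ q) (hb : IsHub b) :
    ∃ g ≠ 1, Commute b g ∧ Commute g (collapse p q) := by
  cases hb with
  | const x =>
    obtain ⟨g, hg, hgp, hgx⟩ :=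
      exists_commute_const_of_isIdempotentElem (by simp) (isIdempotentElem_collapse p q) x
    exact ⟨g, hg, hgx.symm, hgp.symm⟩
  | @collapse p' q' =>
    have havoid : ∀ p p' : ZMod 2 × ZMod 2, ∃ z, z ≠ p ∧ z ≠ p' := by decide
    obtain ⟨z, hp, hp'⟩ := havoid p p'
    exact exists_commute_of_common_fixed_point (collapse_of_ne hp') (collapse_of_ne hp)
  | translation hv => exact exists_commute_translation_of_isHub (.collapse hpq) hv
  | idempotent _ he hv hve =>
    obtain ⟨z, hz, hbz⟩ := exists_apply_eq_self_and_ne he hv hve p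
    exact exists_commute_of_common_fixed_point hbz (collapse_of_ne hz)

theorem exists_commute_of_isHub (ha : IsHub a) (hb : IsHub b) :
    ∃ g ≠ 1, Commute a g ∧ Commute g b := by
  have hsymm {a b : FullTransformation (ZMod 2 × ZMod 2)} :
      (∃ g ≠ 1, Commute a g ∧ Commute g b) → ∃ g ≠ 1, Commute b g ∧ Commute g a :=
    fun ⟨g, hg, hag, hgb⟩ => ⟨g, hg, hgb.symm, hag.symm⟩
  cases hb with
  | collapse hpq => exact exists_commute_collapse_of_isHub hpq ha
  | translation hw => exact hsymm (exists_commute_translation_of_isHub ha hw)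
  | const y =>
    cases ha with
    | const x =>
      exact exists_commute_const_of_isIdempotentElem (by simp) (rfl : IsIdempotentElem (const x)) y
    | translation hv => exact exists_commute_translation_of_isHub (.const y) hv
    | collapse hpq =>
      exact exists_commute_const_of_isIdempotentElem (by simp) (isIdempotentElem_collapse _ _) y
    | idempotent _ he => exact exists_commute_const_of_isIdempotentElem (by simp) he y
  | idempotent _ he hw hwb =>
    cases ha with
    | const x => exact hsymm (exists_commute_const_of_isIdempotentElem (by simp) he x)
    | translation hv => exact ⟨_, translation_ne_one hw, commute_translation _ _, hwb⟩
    | collapse hpq =>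
      exact hsymm (exists_commute_collapse_of_isHub hpq (.idempotent ‹_› he hw hwb))
    | idempotent _ he' hv hva => exact exists_commute_of_commute_translation he' he hv hw hva hwb

theorem ediam_klein_le_four :
    (commutingGraph (FullTransformation (ZMod 2 × ZMod 2))).ediam ≤ 4 := by
  refine ediam_le_iff.2 fun a b _ hb => ?_
  obtain ⟨c, hc, hac⟩ := exists_isHub_commute a
  obtain ⟨d, hd, hbd⟩ := exists_isHub_commute b
  obtain ⟨g, hg, hcg, hgd⟩ := exists_commute_of_isHub hc hd
  simp only [commutingChain_succ_iff]
  exact ⟨c, hc.ne_one, hac, g, hg, hcg, d, hd.ne_one, hgd, b, hb, hbd.symm, rfl⟩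

end Klein

theorem four_le_ediam [Finite X] (hX : 2 ≤ Nat.card X) :
    4 ≤ (commutingGraph (FullTransformation X)).ediam := by
  have : NeZero (Nat.card X) := ⟨by omega⟩
  obtain ⟨u⟩ : Nonempty (X ≃ ZMod (Nat.card X)) := Finite.card_eq.1 (Nat.card_zmod _).symm
  rw [ediam_eq_of_equiv u]
  exact four_le_ediam_zmod hX

theorem not_connected_of_prime_card (hX : (Nat.card X).Prime) :
    ¬ (commutingGraph (FullTransformation X)).Connected := by
  have : Fact (Nat.card X).Prime := ⟨hX⟩
  have : Finite X := Nat.finite_of_card_ne_zero hX.ne_zero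
  obtain ⟨u⟩ : Nonempty (X ≃ ZMod (Nat.card X)) := Finite.card_eq.1 (Nat.card_zmod _).symm
  rw [(commutingGraphCongr (congr u)).connected_iff]
  exact not_connected_zmod _

theorem ediam_le_four_of_card_eq_four (hX : Nat.card X = 4) :
    (commutingGraph (FullTransformation X)).ediam ≤ 4 := by
  have : Finite X := Nat.finite_of_card_ne_zero (by omega)
  obtain ⟨u⟩ : Nonempty (X ≃ ZMod 2 × ZMod 2) := Finite.card_eq.1 (by simp [hX])
  rw [ediam_eq_of_equiv u]
  exact ediam_klein_le_four

theorem five_le_ediam_of_six_le_card (hX : 6 ≤ Nat.card X) :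
    5 ≤ (commutingGraph (FullTransformation X)).ediam := by
  have : Finite X := Nat.finite_of_card_ne_zero (by omega)
  obtain hX | hX := hX.eq_or_lt
  · obtain ⟨u⟩ : Nonempty (X ≃ ZMod 6) := Finite.card_eq.1 (by simp [← hX])
    rw [ediam_eq_of_equiv u]
    exact five_le_ediam_zmod_six
  · obtain ⟨t, r, ht0, htr, hr, hcard⟩ :
        ∃ t r, 0 < t ∧ t < r ∧ 3 ≤ r ∧ Nat.card X = t + (r + r) :=
      ⟨Nat.card X - 2 * ((Nat.card X - 1) / 2), (Nat.card X - 1) / 2, by omega⟩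
    have : NeZero r := ⟨by omega⟩
    obtain ⟨u⟩ : Nonempty (X ≃ GridPoint t r) := Finite.card_eq.1 (by simp [hcard])
    rw [ediam_eq_of_equiv u]
    exact GridPoint.five_le_ediam hr ht0 htr

theorem ediam_le_five_of_not_prime_card [Finite X] (hX : 3 ≤ Nat.card X)
    (hprime : ¬ (Nat.card X).Prime) : (commutingGraph (FullTransformation X)).ediam ≤ 5 :=
  ediam_le_iff.2 fun _ _ => commutingChain_five hX hprime

end FullTransformation

theorem mainTheorem7 {X : Type*} [Fintype X] (n : ℕ) (hX : Fintype.card X = n) (hn : 2 ≤ n) :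
    (n.Prime → ¬ (commutingGraph (FullTransformation X)).Connected) ∧
    (n = 4 → (commutingGraph (FullTransformation X)).ediam = 4) ∧
    (6 ≤ n → ¬ n.Prime → (commutingGraph (FullTransformation X)).ediam = 5) := by
  rw [← Nat.card_eq_fintype_card] at hX
  subst hX
  refine ⟨FullTransformation.not_connected_of_prime_card, fun h4 => ?_, fun h6 hprime => ?_⟩
  · exact le_antisymm (FullTransformation.ediam_le_four_of_card_eq_four h4)
      (FullTransformation.four_le_ediam hn)
  · exact le_antisymm (FullTransformation.ediam_le_five_of_not_prime_card (by omega) hprime)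
      (FullTransformation.five_le_ediam_of_six_le_card h6)
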